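/- Let $\mathsf X$ be a denumerable set of variables, and let the terms of the probabilistic $\lambda$-calculus $\Lambda_\oplus$ be $M,N ::= x \mid \lambda x.M \mid MN \mid M\oplus N$ with $x\in\mathsf X$. For a finite $\overline x\subseteq\mathsf X$, $\Lambda_\oplus(\overline x)$ is the set of terms whose free variables are in $\overline x$; terms in $\Lambda_\oplus(\emptyset)$ are closed, and values are closed abstractions. Write $M\{N/x\}$ for capture-avoiding substitution. *Semantics.* Judgments $M\Downarrow\mathscr D$, with $\mathscr D$ a finitely supported function from values to nonnegative reals, are generated by: $M\Downarrow 0$; $V\Downarrow\delta_V$ for every value $V$; if $M\Downarrow\mathscr D$ and $P\{N/x\}\Downarrow\mathscr E_{P,N}$ for every $\lambda x.P\in\mathrm{supp}(\mathscr D)$, then $MN\Downarrow\sum_{\lambda x.P\in\mathrm{supp}(\mathscr D)}\mathscr D(\lambda x.P)\cdot\mathscr E_{P,N}$; if $M\Downarrow\mathscr D$ and $N\Downarrow\mathscr E$, then $M\oplus N\Downarrow\frac12\mathscr D+\frac12\mathscr E$. For closed $M$, let $[\![M]\!]=\sup_{M\Downarrow\mathscr D}\mathscr D$ (pointwise), and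 write $M\Downarrow_p$ if $\sum_V[\![M]\!](V)=p$. *Context preorder.* Contexts are $C ::= [\cdot]\mid\lambda x.C\mid CM\mid MC\mid C\oplus M\mid M\oplus C$, and $C[M]$ is the result of filling the hole with $M$, possibly with capture of variables. The sets $\mathsf C(\overline x;\overline y)$ are generated by: $[\cdot]\in\mathsf C(\overline x;\overline x)$; $\lambda x.C\in\mathsf C(\overline x;\overline y)$ if $x\notin\overline y$ and $C\in\mathsf C(\overline x;\overline y\cup\{x\})$; and $CM,\ MC,\ C\oplus M,\ M\oplus C\in\mathsf C(\overline x;\overline y)$ if $C\in\mathsf C(\overline x;\overline y)$ and $M\in\Lambda_\oplus(\overline y)$. For $M,N\in\Lambda_\oplus(\overline x)$, the probabilistic context preorder $\overline x\vdash M\leq_\oplus N$ holds iff for every $C\in\mathsf C(\overline x;\emptyset)$, $C[M]\Downarrow_p$ implies $C[N]\Downarrow_q$ with $p\le q$. Context equivalence $\overline x\vdash M\simeq_\oplus N$ means $\overline x\vdash M\leq_\oplus N$ and $\overline x\vdash N\leq_\oplus M$. *CIU preorder.* Frame stacks are $\mathbf S ::= \mathtt{nil}\mid M::\mathbf S$;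 a frame stack is closed if all the terms in it are closed. Let $(\mathbf S,MN)\leadsto(N::\mathbf S,M)$; $(\mathbf S,M\oplus N)\leadsto(\mathbf S,M),(\mathbf S,N)$; $(M::\mathbf S,\lambda x.N)\leadsto(\mathbf S,N\{M/x\})$. Judgments $(\mathbf S,M)\downarrow_p$ are generated by: $(\mathbf S,M)\downarrow_0$; $(\mathtt{nil},V)\downarrow_1$ for every value $V$; if $(\mathbf S,M)\leadsto(\mathbf T_1,N_1),\dots,(\mathbf T_n,N_n)$ and $(\mathbf T_i,N_i)\downarrow_{p_i}$ for all $i$, then $(\mathbf S,M)\downarrow_{\frac1n\sum_{i=1}^n p_i}$. Let $\mathcal C(\mathbf S,M)=\sup\{p : (\mathbf S,M)\downarrow_p\}$. For closed $M,N$, $M\preceq^{\mathsf{CIU}}N$ iff $\mathcal C(\mathbf S,M)\le\mathcal C(\mathbf S,N)$ for every closed frame stack $\mathbf S$. For $M,N\in\Lambda_\oplus(\overline x)$, $\overline x\vdash M\preceq^{\mathsf{CIU}}N$ iff $M\sigma\preceq^{\mathsf{CIU}}N\sigma$ for every substitution $\sigma$ of closed terms for the variables in $\overline x$. CIU-equivalence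 $\overline x\vdash M\cong^{\mathsf{CIU}}N$ means $\overline x\vdash M\preceq^{\mathsf{CIU}}N$ and $\overline x\vdash N\preceq^{\mathsf{CIU}}M$. **Theorem.** For every finite $\overline x\subseteq\mathsf X$ and all $M,N\in\Lambda_\oplus(\overline x)$, $$\overline x\vdash M\preceq^{\mathsf{CIU}}N\iff\overline x\vdash M\leq_\oplus N .$$ Hence also $\overline x\vdash M\cong^{\mathsf{CIU}}N\iff\overline x\vdash M\simeq_\oplus N$. -/

import Mathlib

open scoped NNReal ENNReal

noncomputable section

namespace ProbLambda

/-! ### Terms -/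

/-- The denumerable set of variables. -/
abbrev Var : Type := ℕ

/-- Terms of the untyped probabilistic lambda-calculus: variables, abstractions, applications
and fair binary probabilistic choices. -/
inductive Term : Type
  | var (x : Var) : Term
  | lam (x : Var) (M : Term) : Term
  | app (M N : Term) : Term
  | choice (M N : Term) : Term

namespace Term

/-- Free variables. -/
def fv : Term → Finset Var
  | var x => {x}
  | lam x M => M.fv.erase x
  | app M N => M.fv ∪ N.fv
  | choice M N => M.fv ∪ N.fv

/-- A variable that does not belong to the given finite set. -/
def fresh (A : Finset Var) : Var := A.sup id + 1

theorem fresh_notMem (A : Finset Var) : fresh A ∉ A := by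
  intro h
  exact Nat.not_succ_le_self _ (Finset.le_sup (f := id) h : A.sup id + 1 ≤ A.sup id)

/-- Simultaneous capture-avoiding substitution: every free occurrence of each variable `x` is
replaced by `σ x`. The bound variable of an abstraction is renamed exactly if keeping it would
capture a free variable of a substituted term; in particular it is never renamed when closed
terms are substituted. -/
def substAll : Term → (Var → Term) → Term
  | var x, σ => σ x
  | lam y M, σ =>
      let avoid : Finset Var := (M.fv.erase y).biUnion (fun w => (σ w).fv)
      let z : Var := if y ∈ avoid then fresh avoid else y
      lam z (M.substAll (Function.update σ y (var z)))
  | app M N, σ => app (M.substAll σ) (N.substAll σ)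
  | choice M N, σ => choice (M.substAll σ) (N.substAll σ)

/-- Capture-avoiding substitution of `N` for the free occurrences of `x` in `M`. -/
def subst (M : Term) (x : Var) (N : Term) : Term :=
  M.substAll (Function.update var x N)

/-- A value is a closed abstraction. -/
def IsValue (M : Term) : Prop := M.fv = ∅ ∧ ∃ (x : Var) (P : Term), M = lam x P

end Term

/-- The set of terms whose free variables are among `xs`. -/
def terms (xs : Finset Var) : Set Term := {M | M.fv ⊆ xs}

/-- The set of values. -/
abbrev Value : Type := {V : Term // V.IsValue}

/-! ### Call-by-name semantics -/

/-- Big-step call-by-name approximation semantics: `BigStep M D` says that the finitely supported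
value distribution `D` is a lower approximation of the semantics of `M`. -/
inductive BigStep : Term → (Value →₀ ℝ≥0) → Prop
  | empty (M : Term) : BigStep M 0
  | value (V : Value) : BigStep V.1 (Finsupp.single V 1)
  | app {M N : Term} {D : Value →₀ ℝ≥0} {E : Value → (Value →₀ ℝ≥0)}
      (hM : BigStep M D)
      (hE : ∀ (x : Var) (P : Term) (hV : (Term.lam x P).IsValue),
        (⟨Term.lam x P, hV⟩ : Value) ∈ D.support →
          BigStep (P.subst x N) (E ⟨Term.lam x P, hV⟩)) :
      BigStep (Term.app M N) (∑ V ∈ D.support, D V • E V)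
  | choice {M N : Term} {D E : Value →₀ ℝ≥0} (hM : BigStep M D) (hN : BigStep N E) :
      BigStep (Term.choice M N) ((1 / 2 : ℝ≥0) • D + (1 / 2 : ℝ≥0) • E)

/-- The semantics of a term: the pointwise supremum of its approximations. -/
def sem (M : Term) (V : Value) : ℝ≥0∞ :=
  ⨆ (D : Value →₀ ℝ≥0) (_ : BigStep M D), (D V : ℝ≥0∞)

/-- `M` converges with probability `p`, that is, the total mass of its semantics is `p`. -/
def Converges (M : Term) (p : ℝ≥0∞) : Prop := ∑' V : Value, sem M V = p

/-! ### Contexts and the context preorder -/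

/-- Term contexts: syntax trees with a unique hole. -/
inductive Ctx : Type
  | hole : Ctx
  | lam (x : Var) (C : Ctx) : Ctx
  | appL (C : Ctx) (M : Term) : Ctx
  | appR (M : Term) (C : Ctx) : Ctx
  | choiceL (C : Ctx) (M : Term) : Ctx
  | choiceR (M : Term) (C : Ctx) : Ctx

/-- Filling the hole; free variables of the filling term may be captured. -/
def Ctx.fill : Ctx → Term → Term
  | .hole, N => N
  | .lam x C, N => .lam x (C.fill N)
  | .appL C M, N => .app (C.fill N) M
  | .appR M C, N => .app M (C.fill N)
  | .choiceL C M, N => .choice (C.fill N) M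
  | .choiceR M C, N => .choice M (C.fill N)

/-- `CtxIn xs C ys`: filling the hole of `C` with a term with free variables among `xs`
yields a term with free variables among `ys`, the variables in `xs` but not in `ys` being bound on
the way to the hole. -/
inductive CtxIn (xs : Finset Var) : Ctx → Finset Var → Prop
  | hole : CtxIn xs Ctx.hole xs
  | lam {x : Var} {C : Ctx} {ys : Finset Var} (hx : x ∉ ys) (hC : CtxIn xs C (insert x ys)) :
      CtxIn xs (Ctx.lam x C) ys
  | appL {C : Ctx} {M : Term} {ys : Finset Var} (hC : CtxIn xs C ys) (hM : M ∈ terms ys) :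
      CtxIn xs (Ctx.appL C M) ys
  | appR {C : Ctx} {M : Term} {ys : Finset Var} (hM : M ∈ terms ys) (hC : CtxIn xs C ys) :
      CtxIn xs (Ctx.appR M C) ys
  | choiceL {C : Ctx} {M : Term} {ys : Finset Var} (hC : CtxIn xs C ys) (hM : M ∈ terms ys) :
      CtxIn xs (Ctx.choiceL C M) ys
  | choiceR {C : Ctx} {M : Term} {ys : Finset Var} (hM : M ∈ terms ys) (hC : CtxIn xs C ys) :
      CtxIn xs (Ctx.choiceR M C) ys

/-- The probabilistic context preorder on terms with free variables among `xs`. -/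
def CtxLE (xs : Finset Var) (M N : Term) : Prop :=
  ∀ C : Ctx, CtxIn xs C ∅ → ∀ p : ℝ≥0∞, Converges (C.fill M) p →
    ∃ q : ℝ≥0∞, Converges (C.fill N) q ∧ p ≤ q

/-- Probabilistic context equivalence. -/
def CtxEquiv (xs : Finset Var) (M N : Term) : Prop := CtxLE xs M N ∧ CtxLE xs N M

/-! ### Frame stacks and the CIU preorder -/

/-- Frame stacks: `push M S` stands for the evaluation context that applies its argument to `M`
and then continues with `S`. -/
inductive FrameStack : Type
  | nil : FrameStack
  | push (M : Term) (S : FrameStack) : FrameStack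

/-- Free variables of a frame stack. -/
def FrameStack.fv : FrameStack → Finset Var
  | .nil => ∅
  | .push M S => M.fv ∪ S.fv

/-- The set of frame stacks whose free variables are among `xs`. -/
def frameStacks (xs : Finset Var) : Set FrameStack := {S | S.fv ⊆ xs}

/-- One step of reduction from a pair (frame stack, term) to a sequence of such pairs. -/
inductive Step : FrameStack × Term → List (FrameStack × Term) → Prop
  | app (S : FrameStack) (M N : Term) :
      Step (S, Term.app M N) [(FrameStack.push N S, M)]
  | choice (S : FrameStack) (M N : Term) :
      Step (S, Term.choice M N) [(S, M), (S, N)]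
  | lam (S : FrameStack) (M : Term) (x : Var) (N : Term) :
      Step (FrameStack.push M S, Term.lam x N) [(S, N.subst x M)]

/-- `StackConv c p`: it is derivable that the pair `c = (S, M)` converges with probability (at
least) `p`. -/
inductive StackConv : FrameStack × Term → ℝ≥0 → Prop
  | empty (S : FrameStack) (M : Term) : StackConv (S, M) 0
  | value {V : Term} (hV : V.IsValue) : StackConv (FrameStack.nil, V) 1
  | term {c : FrameStack × Term} {l : List (FrameStack × Term)} {p : Fin l.length → ℝ≥0}
      (hc : Step c l) (hp : ∀ i : Fin l.length, StackConv (l.get i) (p i)) :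
      StackConv c ((1 / (l.length : ℝ≥0)) * ∑ i, p i)

/-- The convergence probability of the pair (frame stack, term). -/
def stackProb (S : FrameStack) (M : Term) : ℝ≥0∞ :=
  ⨆ (p : ℝ≥0) (_ : StackConv (S, M) p), (p : ℝ≥0∞)

/-- The CIU preorder on closed terms. -/
def CIUClosedLE (M N : Term) : Prop :=
  ∀ S ∈ frameStacks ∅, stackProb S M ≤ stackProb S N

/-- The CIU preorder on terms with free variables among `xs`: every closing substitution yields
related closed terms. -/
def CIULE (xs : Finset Var) (M N : Term) : Prop :=
  ∀ σ : Var → Term, (∀ x ∈ xs, σ x ∈ terms ∅) → CIUClosedLE (M.substAll σ) (N.substAll σ)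

/-- CIU-equivalence. -/
def CIUEquiv (xs : Finset Var) (M N : Term) : Prop := CIULE xs M N ∧ CIULE xs N M

end ProbLambda

end

/-! Both preorders reduce to stack probabilities. By adequacy (`tsum_sem_eq_stackProb`), the total
mass of the semantics of a closed term is its convergence probability with the empty stack, so the
context preorder compares `stackProb .nil (C.fill M)` with `stackProb .nil (C.fill N)`.

CIU implies context. Contexts alone are not stable under machine steps, since reduction may
duplicate the hole and substitute into it. `HoleRel` is therefore closed under constructors and
under instances of `M` and `N` by related closing substitutions. A derivation of convergence is
followed by induction on a related stack and term (`StackConv.le_stackProb_of_rel`). When the hole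
is active, `M` under `σ` has the same head as `M` under `τ`, with related subterms, or is a variable
and the argument recurses into its image; the CIU hypothesis for `τ` then passes from `M` to `N`
(`HoleRel.exists_headRel`).

Context implies CIU. A closing substitution is simulated by nested redexes (`bindCtx`) and a closed
stack by successive applications (`FrameStack.plugCtx`), so each CIU test is a context test.

Adequacy has two halves: averaging stack probabilities over an approximation never exceeds the stack
probability of the term (`BigStep.sum_mul_stackProb_le`), and every stack derivation is matched by
an approximation of at least that mass (`StackConv.exists_bigStep`). The latter needs approximations
to be directed. -/

namespace ProbLambda

namespace Term

/-! ### Substitution of closed terms -/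

/-- Simultaneous substitution that never renames bound variables. -/
def csub : Term → (Var → Term) → Term
  | var x, σ => σ x
  | lam y M, σ => lam y (M.csub (Function.update σ y (var y)))
  | app M N, σ => app (M.csub σ) (N.csub σ)
  | choice M N, σ => choice (M.csub σ) (N.csub σ)

/-- A substitution that replaces some variables by closed terms and fixes the others. -/
def Closing (σ : Var → Term) : Prop := ∀ x, σ x = var x ∨ (σ x).fv = ∅

theorem closing_var : Closing var := fun _ => Or.inl rfl

theorem Closing.update {σ : Var → Term} (h : Closing σ) (y : Var) {A : Term}
    (hA : A = var y ∨ A.fv = ∅) : Closing (Function.update σ y A) := by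
  intro x
  by_cases hx : x = y
  · subst hx; simpa using hA
  · simpa [Function.update_of_ne hx] using h x

theorem csub_congr (M : Term) : ∀ {σ τ : Var → Term}, (∀ x ∈ M.fv, σ x = τ x) →
    M.csub σ = M.csub τ := by
  induction M with
  | var x => intro σ τ h; exact h x (by simp [fv])
  | lam y M ih =>
    intro σ τ h
    simp only [csub]
    congr 1
    refine ih fun x hx => ?_
    by_cases hxy : x = y
    · subst hxy; simp
    · simpa [Function.update_of_ne hxy] using h x (by simp [fv, hxy, hx])
  | app M N ihM ihN | choice M N ihM ihN =>
    intro σ τ h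
    simp only [csub]
    rw [ihM fun x hx => h x (by simp [fv, hx]), ihN fun x hx => h x (by simp [fv, hx])]

theorem csub_var (M : Term) : M.csub var = M := by
  induction M with
  | var x => rfl
  | lam y M ih => simp [csub, ih]
  | app M N ihM ihN | choice M N ihM ihN => simp [csub, ihM, ihN]

theorem csub_of_closed {M : Term} (hM : M.fv = ∅) (σ : Var → Term) : M.csub σ = M := by
  conv_rhs => rw [← csub_var M]
  exact csub_congr M (by simp [hM])

/-- Closed images and fixed variables cannot be captured, so no binder is renamed. The condition
concerns free variables only, as CIU substitutions are arbitrary elsewhere. -/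
theorem substAll_eq_csub (M : Term) : ∀ {σ : Var → Term},
    (∀ x ∈ M.fv, σ x = var x ∨ (σ x).fv = ∅) → M.substAll σ = M.csub σ := by
  induction M with
  | var x => intro σ _; rfl
  | lam y M ih =>
    intro σ h
    have hy : y ∉ (M.fv.erase y).biUnion (fun w => (σ w).fv) := by
      simp only [Finset.mem_biUnion, Finset.mem_erase, not_exists, not_and, and_imp]
      intro w hw hwM
      rcases h w (by simp [fv, hw, hwM]) with hσ | hσ
      · simp [hσ, fv, Ne.symm hw]
      · simp [hσ]
    simp only [substAll, csub, if_neg hy]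
    congr 1
    refine ih fun x hx => ?_
    by_cases hxy : x = y
    · subst hxy; simp
    · simpa [Function.update_of_ne hxy] using h x (by simp [fv, hxy, hx])
  | app M N ihM ihN | choice M N ihM ihN =>
    intro σ h
    simp only [substAll, csub]
    rw [ihM fun x hx => h x (by simp [fv, hx]), ihN fun x hx => h x (by simp [fv, hx])]

theorem subst_eq_csub (M : Term) (x : Var) {A : Term} (hA : A.fv = ∅) :
    M.subst x A = M.csub (Function.update var x A) :=
  substAll_eq_csub M fun y _ => closing_var.update x (Or.inr hA) y

/-- Under a binder `y`, the second substitution is changed at `y`; `Closing σ` makes this harmless,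
because an image `σ x` with `x ≠ y` is either `x` itself or closed. -/
theorem csub_csub (M : Term) : ∀ {σ ρ : Var → Term}, Closing σ →
    (M.csub σ).csub ρ = M.csub (fun x => (σ x).csub ρ) := by
  induction M with
  | var x => intro σ ρ _; rfl
  | lam y M ih =>
    intro σ ρ hσ
    simp only [csub]
    rw [ih (hσ.update y (Or.inl rfl))]
    congr 2
    funext x
    by_cases hxy : x = y
    · subst hxy; simp [csub]
    · rw [Function.update_of_ne hxy, Function.update_of_ne hxy]
      rcases hσ x with h | h
      · simp [h, csub, Function.update_of_ne hxy]
      · simp [csub_of_closed h]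
  | app M N ihM ihN | choice M N ihM ihN =>
    intro σ ρ hσ
    simp only [csub]
    rw [ihM hσ, ihN hσ]

theorem fv_csub_subset (M : Term) : ∀ (σ : Var → Term),
    (M.csub σ).fv ⊆ M.fv.biUnion (fun x => (σ x).fv) := by
  induction M with
  | var x => intro σ; simp [csub, fv]
  | lam y M ih =>
    intro σ z hz
    simp only [csub, fv, Finset.mem_erase] at hz
    obtain ⟨w, hw, hzw⟩ := Finset.mem_biUnion.1 (ih _ hz.2)
    have hwy : w ≠ y := by
      rintro rfl
      simp [fv, hz.1] at hzw
    rw [Function.update_of_ne hwy] at hzw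
    exact Finset.mem_biUnion.2 ⟨w, by simp [fv, hwy, hw], hzw⟩
  | app M N ihM ihN | choice M N ihM ihN =>
    intro σ z hz
    simp only [csub, fv, Finset.mem_union] at hz
    rcases hz with hz | hz
    · obtain ⟨w, hw, hzw⟩ := Finset.mem_biUnion.1 (ihM _ hz)
      exact Finset.mem_biUnion.2 ⟨w, by simp [fv, hw], hzw⟩
    · obtain ⟨w, hw, hzw⟩ := Finset.mem_biUnion.1 (ihN _ hz)
      exact Finset.mem_biUnion.2 ⟨w, by simp [fv, hw], hzw⟩

theorem mem_fv_csub (M : Term) : ∀ {σ : Var → Term} {x : Var},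
    x ∈ M.fv → σ x = var x → x ∈ (M.csub σ).fv := by
  induction M with
  | var y =>
    intro σ x hx h
    simp only [fv, Finset.mem_singleton] at hx
    subst hx
    simp [csub, h, fv]
  | lam y M ih =>
    intro σ x hx h
    simp only [fv, Finset.mem_erase] at hx
    simp only [csub, fv, Finset.mem_erase]
    exact ⟨hx.1, ih hx.2 (by rw [Function.update_of_ne hx.1, h])⟩
  | app M N ihM ihN | choice M N ihM ihN =>
    intro σ x hx h
    simp only [fv, csub, Finset.mem_union] at hx ⊢
    exact hx.imp (fun hx => ihM hx h) (fun hx => ihN hx h)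

theorem fv_csub_eq_empty {M : Term} {σ : Var → Term} (h : ∀ x ∈ M.fv, (σ x).fv = ∅) :
    (M.csub σ).fv = ∅ := by
  refine Finset.subset_empty.1 ((fv_csub_subset M σ).trans ?_)
  intro z hz
  obtain ⟨w, hw, hzw⟩ := Finset.mem_biUnion.1 hz
  simp [h w hw] at hzw

/-- A free variable fixed by `σ` would remain free in the result. -/
theorem fv_eq_empty_of_csub {M : Term} {σ : Var → Term} (hσ : Closing σ)
    (h : (M.csub σ).fv = ∅) {x : Var} (hx : x ∈ M.fv) : (σ x).fv = ∅ := by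
  refine (hσ x).resolve_left fun hv => ?_
  simpa [h] using mem_fv_csub M hx hv

theorem fv_subst_eq_empty {x : Var} {P A : Term} (hP : (lam x P).fv = ∅) (hA : A.fv = ∅) :
    (P.subst x A).fv = ∅ := by
  rw [subst_eq_csub P x hA]
  refine fv_csub_eq_empty fun y hy => ?_
  by_cases hyx : y = x
  · subst hyx; simpa using hA
  · have : y ∈ (lam x P).fv := by simp [fv, hyx, hy]
    simp [hP] at this

end Term

open Term

/-! ### Convergence probabilities of frame stacks -/

theorem stackProb_le_iff {S : FrameStack} {M : Term} {r : ℝ≥0∞} :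
    stackProb S M ≤ r ↔ ∀ p : ℝ≥0, StackConv (S, M) p → (p : ℝ≥0∞) ≤ r := by
  simp [stackProb]

theorem StackConv.le_stackProb {S : FrameStack} {M : Term} {p : ℝ≥0} (h : StackConv (S, M) p) :
    (p : ℝ≥0∞) ≤ stackProb S M :=
  stackProb_le_iff.1 le_rfl p h

theorem StackConv.of_step {c d : FrameStack × Term} {p : ℝ≥0} (hc : Step c [d])
    (h : StackConv d p) : StackConv c p := by
  have := StackConv.term (p := fun _ => p) hc (fun i => by
    have hi : i = ⟨0, by simp⟩ := Fin.ext (by have := i.2; simp at this ⊢)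
    subst hi
    exact h)
  simpa using this

theorem stackProb_app (S : FrameStack) (M N : Term) :
    stackProb S (.app M N) = stackProb (.push N S) M := by
  refine le_antisymm (stackProb_le_iff.2 fun p h => ?_)
    (stackProb_le_iff.2 fun p h => (h.of_step (.app S M N)).le_stackProb)
  cases h with
  | empty => simp
  | value hV => obtain ⟨_, _, _, h⟩ := hV; cases h
  | term hc hp =>
    cases hc
    simpa using (hp ⟨0, by simp⟩).le_stackProb

theorem stackProb_push_lam (S : FrameStack) (x : Var) (P A : Term) :
    stackProb (.push A S) (.lam x P) = stackProb S (P.subst x A) := by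
  refine le_antisymm (stackProb_le_iff.2 fun p h => ?_)
    (stackProb_le_iff.2 fun p h => (h.of_step (.lam S A x P)).le_stackProb)
  cases h with
  | empty => simp
  | term hc hp =>
    cases hc
    simpa using (hp ⟨0, by simp⟩).le_stackProb

/-- Two derivations combine into one with the mean probability. The converse inequality is never
needed, as choices on the other side are treated by induction on derivations. -/
theorem le_stackProb_choice (S : FrameStack) (M N : Term) :
    2⁻¹ * (stackProb S M + stackProb S N) ≤ stackProb S (.choice M N) := by
  rw [ENNReal.inv_mul_le_iff (by simp) (by simp)]
  refine ENNReal.biSup_add_biSup_le' ⟨0, .empty S M⟩ ⟨0, .empty S N⟩ fun p hp q hq => ?_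
  rw [← ENNReal.inv_mul_le_iff (by simp) (by simp)]
  have := StackConv.term (p := ![p, q]) (Step.choice S M N) (fun i => by
    match i with
    | ⟨0, _⟩ => exact hp
    | ⟨1, _⟩ => exact hq)
  refine le_trans (le_of_eq ?_) this.le_stackProb
  simp [Fin.sum_univ_two]

theorem one_le_stackProb_nil {V : Term} (hV : V.IsValue) : 1 ≤ stackProb .nil V := by
  simpa using (StackConv.value hV).le_stackProb

/-! ### The substitutive compatible closure of a pair of terms -/

/-- Pairs of substitutions of closed terms for the same variables. -/
def ClosingPair (σ τ : Var → Term) : Prop :=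
  ∀ x, (σ x = .var x ∧ τ x = .var x) ∨ ((σ x).fv = ∅ ∧ (τ x).fv = ∅)

/-- The least relation on terms that is closed under the term constructors and relates `M` to `N`
under related substitutions of closed terms. -/
inductive HoleRel (M N : Term) : Term → Term → Prop
  | var (x : Var) : HoleRel M N (.var x) (.var x)
  | lam (x : Var) {P Q : Term} (h : HoleRel M N P Q) : HoleRel M N (.lam x P) (.lam x Q)
  | app {P Q P' Q' : Term} (h : HoleRel M N P Q) (h' : HoleRel M N P' Q') :
      HoleRel M N (.app P P') (.app Q Q')
  | choice {P Q P' Q' : Term} (h : HoleRel M N P Q) (h' : HoleRel M N P' Q') :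
      HoleRel M N (.choice P P') (.choice Q Q')
  | hole {σ τ : Var → Term} (hστ : ClosingPair σ τ)
      (h : ∀ x, HoleRel M N (σ x) (τ x)) : HoleRel M N (M.csub σ) (N.csub τ)

namespace ClosingPair

variable {σ τ : Var → Term}

theorem left (h : ClosingPair σ τ) : Closing σ := fun x => (h x).imp And.left And.left

theorem right (h : ClosingPair σ τ) : Closing τ := fun x => (h x).imp And.right And.right

theorem update (h : ClosingPair σ τ) (y : Var) {A B : Term}
    (hAB : (A = .var y ∧ B = .var y) ∨ (A.fv = ∅ ∧ B.fv = ∅)) :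
    ClosingPair (Function.update σ y A) (Function.update τ y B) := by
  intro x
  by_cases hx : x = y
  · subst hx; simpa using hAB
  · simpa [Function.update_of_ne hx] using h x

theorem comp (h : ClosingPair σ τ) {ρ θ : Var → Term} (h' : ClosingPair ρ θ) :
    ClosingPair (fun x => (σ x).csub ρ) (fun x => (τ x).csub θ) := by
  intro x
  rcases h x with ⟨h₁, h₂⟩ | ⟨h₁, h₂⟩
  · simpa [h₁, h₂, csub] using h' x
  · exact Or.inr (by simp [csub_of_closed, h₁, h₂])

theorem closed_right (h : ClosingPair σ τ) {x : Var} (hx : (σ x).fv = ∅) : (τ x).fv = ∅ := by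
  rcases h x with ⟨h₁, _⟩ | ⟨_, h₂⟩
  · simp [h₁, fv] at hx
  · exact h₂

end ClosingPair

namespace HoleRel

variable {M N : Term}

theorem refl (P : Term) : HoleRel M N P P := by
  induction P with
  | var x => exact .var x
  | lam x P ih => exact .lam x ih
  | app P Q ihP ihQ => exact .app ihP ihQ
  | choice P Q ihP ihQ => exact .choice ihP ihQ

theorem update {σ τ : Var → Term} (h : ∀ x, HoleRel M N (σ x) (τ x)) (y : Var) {A B : Term}
    (hAB : HoleRel M N A B) (x : Var) :
    HoleRel M N (Function.update σ y A x) (Function.update τ y B x) := by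
  by_cases hx : x = y
  · subst hx; simpa using hAB
  · simpa [Function.update_of_ne hx] using h x

/-- Stability under beta steps. At a hole, the new pair of substitutions is composed with the stored
one, which is why the constructor `hole` carries substitutions. -/
theorem csub {P Q : Term} (hPQ : HoleRel M N P Q) : ∀ {ρ θ : Var → Term}, ClosingPair ρ θ →
    (∀ x, HoleRel M N (ρ x) (θ x)) → HoleRel M N (P.csub ρ) (Q.csub θ) := by
  induction hPQ with
  | var x => intro ρ θ _ h; exact h x
  | lam x _ ih =>
    intro ρ θ hc h
    exact .lam x (ih (hc.update x (Or.inl ⟨rfl, rfl⟩)) (update h x (.var x)))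
  | app _ _ ih ih' => intro ρ θ hc h; exact .app (ih hc h) (ih' hc h)
  | choice _ _ ih ih' => intro ρ θ hc h; exact .choice (ih hc h) (ih' hc h)
  | hole hστ _ ih =>
    intro ρ θ hc h
    rw [csub_csub M hστ.left, csub_csub N hστ.right]
    exact .hole (hστ.comp hc) fun x => ih x hc h

theorem subst {x : Var} {P Q A B : Term} (hPQ : HoleRel M N P Q) (hAB : HoleRel M N A B)
    (hA : A.fv = ∅) (hB : B.fv = ∅) : HoleRel M N (P.subst x A) (Q.subst x B) := by
  rw [subst_eq_csub P x hA, subst_eq_csub Q x hB]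
  have hv : ClosingPair .var .var := fun _ => Or.inl ⟨rfl, rfl⟩
  exact hPQ.csub (hv.update x (Or.inr ⟨hA, hB⟩)) (update .var x hAB)

theorem fill (C : Ctx) : HoleRel M N (C.fill M) (C.fill N) := by
  induction C with
  | hole =>
    have := HoleRel.hole (M := M) (N := N) (σ := .var) (τ := .var)
      (fun _ => Or.inl ⟨rfl, rfl⟩) .var
    rwa [csub_var, csub_var] at this
  | lam x C ih => exact .lam x ih
  | appL C P ih => exact .app ih (refl P)
  | appR P C ih => exact .app (refl P) ih
  | choiceL C P ih => exact .choice ih (refl P)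
  | choiceR P C ih => exact .choice (refl P) ih

end HoleRel

/-- Terms with the same outermost constructor and related immediate subterms. -/
inductive HeadRel (M N : Term) : Term → Term → Prop
  | lam (x : Var) {P Q : Term} (h : HoleRel M N P Q) : HeadRel M N (.lam x P) (.lam x Q)
  | app {P Q P' Q' : Term} (h : HoleRel M N P Q) (h' : HoleRel M N P' Q') :
      HeadRel M N (.app P P') (.app Q Q')
  | choice {P Q P' Q' : Term} (h : HoleRel M N P Q) (h' : HoleRel M N P' Q') :
      HeadRel M N (.choice P P') (.choice Q Q')

/-! ### Simulation of stack derivations up to CIU -/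

theorem CIULE.csub_le {xs : Finset Var} {M N : Term} (h : CIULE xs M N) {τ : Var → Term}
    (hτM : ∀ x ∈ M.fv, (τ x).fv = ∅) (hτN : ∀ x ∈ N.fv, (τ x).fv = ∅) : CIUClosedLE (M.csub τ) (N.csub τ) := by
  -- CIU requires closed images on all of `xs`, while `τ` need only be closed on the free variables
  -- of `M` and `N`; the identity is a dummy closed term elsewhere.
  let τ' : Var → Term := fun x => if (τ x).fv = ∅ then τ x else .lam 0 (.var 0)
  have hτ' : ∀ x, (τ' x).fv = ∅ := by
    intro x
    by_cases hx : (τ x).fv = ∅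
    · simp [τ', hx]
    · simp [τ', hx, fv]
  have key : ∀ P : Term, (∀ x ∈ P.fv, (τ x).fv = ∅) → P.substAll τ' = P.csub τ := by
    intro P hP
    rw [substAll_eq_csub P fun x _ => Or.inr (hτ' x)]
    exact csub_congr P fun x hx => by simp [τ', hP x hx]
  have := h τ' fun x _ => (hτ' x).subset
  rwa [key M hτM, key N hτN] at this

theorem CIUClosedLE.trans {P Q R : Term} (h : CIUClosedLE P Q) (h' : CIUClosedLE Q R) :
    CIUClosedLE P R := fun S hS => (h S hS).trans (h' S hS)

/-- Exposes a common head constructor, so that both sides can make the same machine step; the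
discrepancy with `Q` is left to the CIU preorder. -/
theorem HoleRel.exists_headRel {xs : Finset Var} {M N : Term} (h : CIULE xs M N)
    {P Q : Term} (hPQ : HoleRel M N P Q) (hP : P.fv = ∅) (hQ : Q.fv = ∅) :
    ∃ Q', HeadRel M N P Q' ∧ Q'.fv = ∅ ∧ CIUClosedLE Q' Q := by
  induction hPQ with
  | var x => simp [fv] at hP
  | lam x h => exact ⟨_, .lam x h, hQ, fun _ _ => le_rfl⟩
  | app h h' => exact ⟨_, .app h h', hQ, fun _ _ => le_rfl⟩
  | choice h h' => exact ⟨_, .choice h h', hQ, fun _ _ => le_rfl⟩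
  | @hole σ τ hστ hR ih =>
    have hτM : ∀ x ∈ M.fv, (τ x).fv = ∅ := fun x hx =>
      hστ.closed_right (fv_eq_empty_of_csub hστ.left hP hx)
    have hle : CIUClosedLE (M.csub τ) (N.csub τ) :=
      h.csub_le hτM fun x hx => fv_eq_empty_of_csub hστ.right hQ hx
    have hMτ : (M.csub τ).fv = ∅ := fv_csub_eq_empty hτM
    -- Unless `M` is a variable, `M.csub τ` serves as `Q'`. A variable exposes no constructor, so
    -- the induction hypothesis for the related images of `x` is chained with CIU.
    rcases hMe : M with x | ⟨x, P⟩ | ⟨P, P'⟩ | ⟨P, P'⟩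
    · have hx : x ∈ M.fv := by simp [hMe, fv]
      obtain ⟨Q', h₁, h₂, h₃⟩ := ih x (fv_eq_empty_of_csub hστ.left hP hx) (hτM x hx)
      refine ⟨Q', by simpa [hMe, Term.csub] using h₁, h₂, h₃.trans ?_⟩
      simpa [hMe, Term.csub] using hle
    · refine ⟨M.csub τ, ?_, hMτ, hle⟩
      rw [← hMe]
      have : HoleRel M N (P.csub (Function.update σ x (.var x)))
          (P.csub (Function.update τ x (.var x))) :=
        (HoleRel.refl P).csub (hστ.update x (Or.inl ⟨rfl, rfl⟩)) (HoleRel.update hR x (.var x))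
      have h₂ := HeadRel.lam x this
      have e : ∀ ρ, M.csub ρ = .lam x (P.csub (Function.update ρ x (.var x))) := by
        intro ρ; rw [hMe]; rfl
      rwa [← e, ← e] at h₂
    · refine ⟨M.csub τ, ?_, hMτ, hle⟩
      rw [← hMe]
      have h₂ := HeadRel.app ((HoleRel.refl P).csub hστ hR) ((HoleRel.refl P').csub hστ hR)
      have e : ∀ ρ, M.csub ρ = .app (P.csub ρ) (P'.csub ρ) := by
        intro ρ; rw [hMe]; rfl
      rwa [← e, ← e] at h₂
    · refine ⟨M.csub τ, ?_, hMτ, hle⟩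
      rw [← hMe]
      have h₂ := HeadRel.choice ((HoleRel.refl P).csub hστ hR) ((HoleRel.refl P').csub hστ hR)
      have e : ∀ ρ, M.csub ρ = .choice (P.csub ρ) (P'.csub ρ) := by
        intro ρ; rw [hMe]; rfl
      rwa [← e, ← e] at h₂

/-- Frame stacks whose terms are pointwise related. -/
inductive StackRel (M N : Term) : FrameStack → FrameStack → Prop
  | nil : StackRel M N .nil .nil
  | push {P Q : Term} {S T : FrameStack} (h : HoleRel M N P Q) (hS : StackRel M N S T) :
      StackRel M N (.push P S) (.push Q T)

/-- Induction on the left derivation: replace the right term by one with the same head, at no gain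
by CIU for the stack `T`, then step both sides. A beta step preserves the relation by
`HoleRel.subst`. -/
theorem StackConv.le_stackProb_of_rel {xs : Finset Var} {M N : Term} (h : CIULE xs M N)
    {c : FrameStack × Term} {p : ℝ≥0}
    (hc : StackConv c p) : ∀ {T : FrameStack} {Q : Term}, StackRel M N c.1 T →
      HoleRel M N c.2 Q → c.1.fv = ∅ → T.fv = ∅ → c.2.fv = ∅ → Q.fv = ∅ →
      (p : ℝ≥0∞) ≤ stackProb T Q := by
  induction hc with
  | empty => intros; simp
  | value hV =>
    intro T Q hS hPQ _ _ hP hQ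
    obtain ⟨Q', hQ', hc', hle⟩ := hPQ.exists_headRel h hP hQ
    obtain ⟨_, x, P, rfl⟩ := hV
    cases hS
    cases hQ' with
    | lam _ hPQ =>
      refine le_trans ?_ (hle .nil (by simp [frameStacks, FrameStack.fv]))
      simpa using one_le_stackProb_nil ⟨hc', _, _, rfl⟩
  | term hc hp ih =>
    intro T Q hS hPQ hSc hTc hP hQ
    obtain ⟨Q', hQ', hc', hle⟩ := hPQ.exists_headRel h hP hQ
    refine le_trans ?_ (hle T hTc.subset)
    cases hc with
    | app S P P' =>
      cases hQ' with
      | app h₁ h₂ =>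
        simp only [fv, Finset.union_eq_empty] at hP hc'
        rw [stackProb_app]
        simpa using ih ⟨0, by simp⟩ (.push h₂ hS) h₁ (by simpa [FrameStack.fv] using ⟨hP.2, hSc⟩)
          (by simpa [FrameStack.fv] using ⟨hc'.2, hTc⟩) hP.1 hc'.1
    | choice S P P' =>
      cases hQ' with
      | choice h₁ h₂ =>
        simp only [fv, Finset.union_eq_empty] at hP hc'
        refine le_trans ?_ (le_stackProb_choice _ _ _)
        have i₁ := ih ⟨0, by simp⟩ hS h₁ hSc hTc hP.1 hc'.1
        have i₂ := ih ⟨1, by simp⟩ hS h₂ hSc hTc hP.2 hc'.2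
        refine le_trans (le_of_eq ?_) (mul_le_mul_right (add_le_add i₁ i₂) _)
        simp [Fin.sum_univ_two]
    | lam S A x P =>
      cases hQ' with
      | lam _ h₁ =>
        cases hS with
        | push h₂ hS =>
          simp only [FrameStack.fv, Finset.union_eq_empty] at hSc hTc
          rw [stackProb_push_lam]
          simpa using ih ⟨0, by simp⟩ hS (h₁.subst h₂ hSc.1 hTc.1) hSc.2 hTc.2
            (fv_subst_eq_empty hP hSc.1) (fv_subst_eq_empty hc' hTc.1)

/-! ### Adequacy of the big-step semantics -/

/-- The term obtained from a value by contracting its application to `N`. -/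
def Value.apply (V : Value) (N : Term) : Term :=
  match V.1 with
  | .lam x P => P.subst x N
  | M => M

/-- The total mass of a value distribution. -/
noncomputable def mass (D : Value →₀ ℝ≥0) : ℝ≥0∞ := ∑ V ∈ D.support, (D V : ℝ≥0∞)

theorem BigStep.app_apply {M N : Term} {D : Value →₀ ℝ≥0} {E : Value → (Value →₀ ℝ≥0)}
    (hM : BigStep M D) (hE : ∀ V, BigStep (V.apply N) (E V)) :
    BigStep (.app M N) (Finsupp.linearCombination ℝ≥0 E D) := by
  rw [Finsupp.linearCombination_apply]
  exact .app hM fun x P hV _ => hE ⟨.lam x P, hV⟩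

theorem BigStep.exists_of_app {M N : Term} {D : Value →₀ ℝ≥0} (h : BigStep (.app M N) D) :
    ∃ (F : Value →₀ ℝ≥0) (E : Value → (Value →₀ ℝ≥0)), BigStep M F ∧
      (∀ V, BigStep (V.apply N) (E V)) ∧ D = Finsupp.linearCombination ℝ≥0 E F := by
  generalize hP : Term.app M N = P at h
  cases h with
  | empty => exact ⟨0, 0, .empty _, fun _ => .empty _, by simp⟩
  | value V =>
    obtain ⟨_, _, hV, _, _, rfl⟩ := V
    cases hP
  | choice => cases hP
  | @app _ _ F E hM hE =>
    cases hP
    classical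
    -- The rule constrains `E` only on the support; the approximation `0` makes it total without
    -- changing the combination.
    refine ⟨F, fun V => if V ∈ F.support then E V else 0, hM, fun V => ?_, ?_⟩
    · obtain ⟨_, hV, x, P, rfl⟩ := V
      by_cases hF : (⟨.lam x P, hV, x, P, rfl⟩ : Value) ∈ F.support
      · simp only [if_pos hF]
        exact hE x P _ hF
      · simp only [if_neg hF]
        exact .empty _
    · rw [Finsupp.linearCombination_apply, Finsupp.sum]
      exact Finset.sum_congr rfl fun V hV => by rw [if_pos hV]

theorem linearCombination_mono {E E' : Value → (Value →₀ ℝ≥0)} {F F' : Value →₀ ℝ≥0}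
    (hE : ∀ V, E V ≤ E' V) (hF : F ≤ F') :
    Finsupp.linearCombination ℝ≥0 E F ≤ Finsupp.linearCombination ℝ≥0 E' F' := by
  intro W
  rw [Finsupp.linearCombination_apply, Finsupp.linearCombination_apply, Finsupp.sum, Finsupp.sum,
    Finsupp.finsetSum_apply, Finsupp.finsetSum_apply]
  calc ∑ V ∈ F.support, (F V • E V) W ≤ ∑ V ∈ F.support, (F' V • E' V) W :=
        Finset.sum_le_sum fun V _ => by
          simpa using mul_le_mul' (hF V) (hE V W)
    _ ≤ ∑ V ∈ F'.support, (F' V • E' V) W :=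
        Finset.sum_le_sum_of_subset (Finsupp.support_mono hF)

theorem BigStep.eq_zero_or_single {V : Value} {D : Value →₀ ℝ≥0} (h : BigStep V.1 D) :
    D = 0 ∨ D = Finsupp.single V 1 := by
  generalize hM : V.1 = M at h
  cases h with
  | empty => exact Or.inl rfl
  | value W => exact Or.inr (by rw [Subtype.ext hM])
  | app | choice =>
    obtain ⟨_, _, x, P, rfl⟩ := V
    cases hM

/-- For applications, first bound the two distributions of the function, then bound pointwise the
two families for the contracta; the combination is monotone in both. -/
theorem BigStep.directed {M : Term} {D : Value →₀ ℝ≥0} (h : BigStep M D) :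
    ∀ {D' : Value →₀ ℝ≥0}, BigStep M D' → ∃ D'', BigStep M D'' ∧ D ≤ D'' ∧ D' ≤ D'' := by
  induction h with
  | empty => intro D' h'; exact ⟨D', h', zero_le, le_rfl⟩
  | value V =>
    intro D' h'
    refine ⟨_, .value V, le_rfl, ?_⟩
    rcases h'.eq_zero_or_single with rfl | rfl
    · exact zero_le
    · exact le_rfl
  | @app M N D E hM hE ihM ihE =>
    intro D' h'
    obtain ⟨F', E', hF', hE', rfl⟩ := h'.exists_of_app
    obtain ⟨F, hF, hDF, hF'F⟩ := ihM hF'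
    classical
    have key : ∀ V, ∃ G, BigStep (V.apply N) G ∧ (if V ∈ D.support then E V else 0) ≤ G ∧
        E' V ≤ G := by
      intro V
      by_cases hV : V ∈ D.support
      · simp only [if_pos hV]
        obtain ⟨_, hc, x, P, rfl⟩ := V
        exact ihE x P _ hV (hE' ⟨.lam x P, hc, x, P, rfl⟩)
      · simp only [if_neg hV]
        exact ⟨E' V, hE' V, zero_le, le_rfl⟩
    choose G hG hEG hE'G using key
    refine ⟨_, hF.app_apply hG, ?_, linearCombination_mono hE'G hF'F⟩
    refine le_trans (le_of_eq ?_) (linearCombination_mono hEG hDF)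
    rw [Finsupp.linearCombination_apply, Finsupp.sum]
    exact Finset.sum_congr rfl fun V hV => by rw [if_pos hV]
  | choice hM hN ihM ihN =>
    intro D' h'
    generalize hP : Term.choice _ _ = P at h'
    cases h' with
    | empty => exact ⟨_, hP ▸ .choice hM hN, le_rfl, zero_le⟩
    | value V =>
      obtain ⟨_, _, _, _, rfl⟩ := V
      cases hP
    | app => cases hP
    | choice hM' hN' =>
      cases hP
      obtain ⟨F, hF, h₁, h₂⟩ := ihM hM'
      obtain ⟨G, hG, h₃, h₄⟩ := ihN hN'
      exact ⟨_, .choice hF hG, by gcongr, by gcongr⟩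

/-- Application is linear in the function's distribution once the families for the contracta are
fixed; directedness replaces the two families by a common bound. -/
theorem BigStep.exists_mix_app {M₁ M₂ M : Term} (A : Term)
    (h : ∀ D₁ D₂, BigStep M₁ D₁ → BigStep M₂ D₂ →
      ∃ D, BigStep M D ∧ (1 / 2 : ℝ≥0) • D₁ + (1 / 2 : ℝ≥0) • D₂ ≤ D)
    (D₁ D₂ : Value →₀ ℝ≥0) (h₁ : BigStep (.app M₁ A) D₁) (h₂ : BigStep (.app M₂ A) D₂) :
    ∃ D, BigStep (.app M A) D ∧ (1 / 2 : ℝ≥0) • D₁ + (1 / 2 : ℝ≥0) • D₂ ≤ D := by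
  obtain ⟨F₁, E₁, hF₁, hE₁, rfl⟩ := h₁.exists_of_app
  obtain ⟨F₂, E₂, hF₂, hE₂, rfl⟩ := h₂.exists_of_app
  obtain ⟨F, hF, hle⟩ := h F₁ F₂ hF₁ hF₂
  choose E hE hE₁' hE₂' using fun V => (hE₁ V).directed (hE₂ V)
  refine ⟨_, hF.app_apply hE, ?_⟩
  refine le_trans ?_ (linearCombination_mono (fun V => le_rfl) hle)
  rw [map_add, map_smul, map_smul]
  gcongr
  · exact linearCombination_mono hE₁' le_rfl
  · exact linearCombination_mono hE₂' le_rfl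

/-- The term obtained by applying `M` successively to the terms of a frame stack. -/
def FrameStack.plug : FrameStack → Term → Term
  | .nil, M => M
  | .push N S, M => S.plug (.app M N)

theorem BigStep.exists_mix_plug (S : FrameStack) : ∀ {M₁ M₂ M : Term},
    (∀ D₁ D₂, BigStep M₁ D₁ → BigStep M₂ D₂ →
      ∃ D, BigStep M D ∧ (1 / 2 : ℝ≥0) • D₁ + (1 / 2 : ℝ≥0) • D₂ ≤ D) →
    ∀ D₁ D₂, BigStep (S.plug M₁) D₁ → BigStep (S.plug M₂) D₂ →
      ∃ D, BigStep (S.plug M) D ∧ (1 / 2 : ℝ≥0) • D₁ + (1 / 2 : ℝ≥0) • D₂ ≤ D := by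
  induction S with
  | nil => intro M₁ M₂ M h; exact h
  | push A S ih => intro M₁ M₂ M h; exact ih (BigStep.exists_mix_app A h)

theorem BigStep.plug_mono (S : FrameStack) : ∀ {M M' : Term},
    (∀ D, BigStep M D → BigStep M' D) → ∀ D, BigStep (S.plug M) D → BigStep (S.plug M') D := by
  induction S with
  | nil => intro M M' h; exact h
  | push A S ih =>
    intro M M' h
    refine ih fun D hD => ?_
    obtain ⟨F, E, hF, hE, rfl⟩ := hD.exists_of_app
    exact (h F hF).app_apply hE

/-! ### Total mass and its comparison with stack probabilities -/

theorem mass_eq_sum {D : Value →₀ ℝ≥0} {s : Finset Value} (hs : D.support ⊆ s) :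
    mass D = ∑ V ∈ s, (D V : ℝ≥0∞) :=
  Finset.sum_subset hs fun V _ hV => by simpa using hV

theorem mass_eq_tsum (D : Value →₀ ℝ≥0) : mass D = ∑' V, (D V : ℝ≥0∞) :=
  (tsum_eq_sum fun V hV => by simpa using hV).symm

theorem mass_mono {D D' : Value →₀ ℝ≥0} (h : D ≤ D') : mass D ≤ mass D' := by
  rw [mass_eq_tsum, mass_eq_tsum]
  exact ENNReal.tsum_le_tsum fun V => by exact_mod_cast h V

theorem mass_mix (D D' : Value →₀ ℝ≥0) :
    mass ((1 / 2 : ℝ≥0) • D + (1 / 2 : ℝ≥0) • D') = 2⁻¹ * (mass D + mass D') := by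
  simp only [mass_eq_tsum]
  rw [← ENNReal.tsum_add, ← ENNReal.tsum_mul_left]
  refine tsum_congr fun V => ?_
  simp [mul_add]

/-- The stack is read back as an evaluation context. Choices and beta steps then occur below it, and
are carried through it by `BigStep.exists_mix_plug` and `BigStep.plug_mono`. -/
theorem StackConv.exists_bigStep {c : FrameStack × Term} {p : ℝ≥0} (h : StackConv c p) :
    c.1.fv = ∅ → c.2.fv = ∅ → ∃ D, BigStep (c.1.plug c.2) D ∧ (p : ℝ≥0∞) ≤ mass D := by
  induction h with
  | empty => intros; exact ⟨0, .empty _, by simp⟩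
  | value hV =>
    intro _ _
    refine ⟨_, .value ⟨_, hV⟩, ?_⟩
    rw [mass_eq_sum Finsupp.support_single_subset]
    simp
  | term hc hp ih =>
    intro hS hM
    cases hc with
    | app S M N =>
      simp only [fv, Finset.union_eq_empty] at hM
      simpa [FrameStack.plug] using
        ih ⟨0, by simp⟩ (by simpa [FrameStack.fv] using ⟨hM.2, hS⟩) hM.1
    | choice S M N =>
      simp only [fv, Finset.union_eq_empty] at hM
      obtain ⟨D₁, h₁, hp₁⟩ := ih ⟨0, by simp⟩ hS hM.1
      obtain ⟨D₂, h₂, hp₂⟩ := ih ⟨1, by simp⟩ hS hM.2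
      obtain ⟨D, hD, hle⟩ := BigStep.exists_mix_plug S (M := .choice M N)
        (fun D₁ D₂ h₁ h₂ => ⟨_, .choice h₁ h₂, le_rfl⟩) D₁ D₂ h₁ h₂
      refine ⟨D, hD, le_trans ?_ (mass_mono hle)⟩
      rw [mass_mix]
      refine le_trans (le_of_eq ?_) (mul_le_mul_right (add_le_add hp₁ hp₂) _)
      simp [Fin.sum_univ_two]
    | lam S A x P =>
      simp only [FrameStack.fv, Finset.union_eq_empty] at hS
      obtain ⟨D, hD, hp⟩ := ih ⟨0, by simp⟩ hS.2 (fv_subst_eq_empty hM hS.1)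
      refine ⟨D, BigStep.plug_mono S (fun D hD => ?_) D hD, by simpa using hp⟩
      classical
      -- The abstraction evaluates to a point mass, so the application inherits `D` from its
      -- contractum.
      have := (BigStep.value ⟨.lam x P, hM, x, P, rfl⟩).app_apply (N := A)
        (E := fun V => if V = ⟨.lam x P, hM, x, P, rfl⟩ then D else 0) fun V => by
          by_cases hV : V = ⟨.lam x P, hM, x, P, rfl⟩
          · subst hV
            rw [if_pos rfl]
            exact hD
          · simpa [hV] using .empty _
      simpa using this

theorem stackProb_apply (S : FrameStack) (V : Value) (N : Term) :
    stackProb S (V.apply N) = stackProb (.push N S) V.1 := by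
  obtain ⟨_, _, x, P, rfl⟩ := V
  exact (stackProb_push_lam S x P N).symm

/-- The stack is arbitrary because in an application the function is evaluated with its argument
pushed. -/
theorem BigStep.sum_mul_stackProb_le {M : Term} {D : Value →₀ ℝ≥0} (h : BigStep M D) :
    ∀ S, ∑' V, (D V : ℝ≥0∞) * stackProb S V.1 ≤ stackProb S M := by
  induction h with
  | empty => simp
  | value V =>
    intro S
    rw [tsum_eq_single V fun W hW => by simp [hW.symm]]
    simp
  | @app M N D E hM hE ihM ihE =>
    intro S
    calc ∑' W, ((∑ V ∈ D.support, D V • E V) W : ℝ≥0∞) * stackProb S W.1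
        = ∑ V ∈ D.support, (D V : ℝ≥0∞) * ∑' W, (E V W : ℝ≥0∞) * stackProb S W.1 := by
          simp_rw [← ENNReal.tsum_mul_left]
          rw [← Summable.tsum_finsetSum fun _ _ => ENNReal.summable]
          refine tsum_congr fun W => ?_
          simp [Finsupp.finsetSum_apply, Finset.sum_mul, mul_assoc]
      _ ≤ ∑ V ∈ D.support, (D V : ℝ≥0∞) * stackProb (.push N S) V.1 := by
          refine Finset.sum_le_sum fun V hV => ?_
          rw [← stackProb_apply]
          obtain ⟨_, hc, x, P, rfl⟩ := V
          exact mul_le_mul_right (ihE x P _ hV S) _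
      _ ≤ ∑' V, (D V : ℝ≥0∞) * stackProb (.push N S) V.1 := ENNReal.sum_le_tsum _
      _ ≤ stackProb S (.app M N) := (ihM _).trans (stackProb_app S M N).ge
  | @choice M N D E _ _ ihM ihN =>
    intro S
    refine le_trans (le_of_eq ?_) ((mul_le_mul_right (add_le_add (ihM S) (ihN S)) _).trans
      (le_stackProb_choice S M N))
    rw [← ENNReal.tsum_add, ← ENNReal.tsum_mul_left]
    refine tsum_congr fun V => ?_
    simp [mul_add, add_mul, mul_assoc]

/-- The pointwise suprema may come from different approximations; directedness allows exchanging
them with finite sums. -/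
theorem tsum_sem_le (M : Term) :
    ∑' V, sem M V ≤ ⨆ (D : Value →₀ ℝ≥0) (_ : BigStep M D), mass D := by
  rw [ENNReal.tsum_eq_iSup_sum]
  refine iSup_le fun s => ?_
  simp only [sem, iSup_subtype']
  rw [ENNReal.finsetSum_iSup fun D D' => ?_]
  · exact iSup_mono fun D => by
      rw [mass_eq_tsum]
      exact ENNReal.sum_le_tsum s
  · obtain ⟨F, hF, h, h'⟩ := D.2.directed D'.2
    exact ⟨⟨F, hF⟩, fun V => ⟨by exact_mod_cast h V, by exact_mod_cast h' V⟩⟩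

theorem mass_le_tsum_sem {M : Term} {D : Value →₀ ℝ≥0} (h : BigStep M D) :
    mass D ≤ ∑' V, sem M V := by
  rw [mass_eq_tsum]
  exact ENNReal.tsum_le_tsum fun V => le_iSup₂_of_le D h le_rfl

theorem tsum_sem_eq_stackProb {M : Term} (hM : M.fv = ∅) : ∑' V, sem M V = stackProb .nil M := by
  refine le_antisymm ((tsum_sem_le M).trans (iSup₂_le fun D hD => ?_)) (stackProb_le_iff.2 fun p hp => ?_)
  · refine le_trans ?_ (hD.sum_mul_stackProb_le .nil)
    rw [mass_eq_tsum]
    exact ENNReal.tsum_le_tsum fun V => le_mul_of_one_le_right' (one_le_stackProb_nil V.2)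
  · obtain ⟨D, hD, hle⟩ := hp.exists_bigStep rfl hM
    exact hle.trans (mass_le_tsum_sem hD)

/-! ### Contexts -/

theorem CtxIn.fill_mem {xs ys : Finset Var} {C : Ctx} (hC : CtxIn xs C ys) {M : Term}
    (hM : M ∈ terms xs) : C.fill M ∈ terms ys := by
  induction hC with
  | hole => exact hM
  | lam hx _ ih =>
    intro z hz
    simp only [Ctx.fill, fv, Finset.mem_erase] at hz
    exact (Finset.mem_insert.1 (ih hz.2)).resolve_left hz.1
  | appL _ hP ih => exact Finset.union_subset ih hP
  | appR hP _ ih => exact Finset.union_subset hP ih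
  | choiceL _ hP ih => exact Finset.union_subset ih hP
  | choiceR hP _ ih => exact Finset.union_subset hP ih

theorem ctxLE_iff {xs : Finset Var} {M N : Term} (hM : M ∈ terms xs) (hN : N ∈ terms xs) :
    CtxLE xs M N ↔ ∀ C, CtxIn xs C ∅ →
      stackProb .nil (C.fill M) ≤ stackProb .nil (C.fill N) := by
  have key : ∀ {C P}, CtxIn xs C ∅ → P ∈ terms xs →
      ∑' V, sem (C.fill P) V = stackProb .nil (C.fill P) := fun hC hP =>
    tsum_sem_eq_stackProb (Finset.subset_empty.1 (hC.fill_mem hP))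
  constructor
  · intro h C hC
    obtain ⟨q, hq, hle⟩ := h C hC _ rfl
    unfold Converges at hq
    rwa [← hq, key hC hM, key hC hN] at hle
  · intro h C hC p hp
    refine ⟨_, rfl, ?_⟩
    unfold Converges at hp
    rw [← hp, key hC hM, key hC hN]
    exact h C hC

/-! ### The two inclusions between the preorders -/

theorem CIULE.ctxLE {xs : Finset Var} {M N : Term} (hM : M ∈ terms xs) (hN : N ∈ terms xs)
    (h : CIULE xs M N) : CtxLE xs M N := by
  refine (ctxLE_iff hM hN).2 fun C hC => stackProb_le_iff.2 fun p hp => ?_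
  exact hp.le_stackProb_of_rel h .nil (HoleRel.fill C) rfl rfl
    (Finset.subset_empty.1 (hC.fill_mem hM)) (Finset.subset_empty.1 (hC.fill_mem hN))

/-- The context that binds the variables of the list to their images under `σ`, by nested
redexes. -/
def bindCtx (σ : Var → Term) : List Var → Ctx
  | [] => .hole
  | x :: l => .appL (.lam x (bindCtx σ l)) (σ x)

/-- The context that applies the filled context `C` to the terms of a frame stack. -/
def FrameStack.plugCtx : FrameStack → Ctx → Ctx
  | .nil, C => C
  | .push N S, C => S.plugCtx (.appL C N)

theorem FrameStack.stackProb_plugCtx (S : FrameStack) : ∀ (C : Ctx) (M : Term),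
    stackProb .nil ((S.plugCtx C).fill M) = stackProb S (C.fill M) := by
  induction S with
  | nil => intro C M; rfl
  | push N S ih => intro C M; rw [FrameStack.plugCtx, ih, Ctx.fill, stackProb_app]

theorem FrameStack.plugCtx_mem {xs ys : Finset Var} (S : FrameStack) : ∀ {C : Ctx},
    S ∈ frameStacks ys → CtxIn xs C ys → CtxIn xs (S.plugCtx C) ys := by
  induction S with
  | nil => intro C _ hC; exact hC
  | push N S ih =>
    intro C hS hC
    exact ih (Finset.union_subset_right hS) (.appL hC (Finset.union_subset_left hS))

/-- Distinctness and disjointness from `ys` supply the side condition that each bound variable be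
new to the context's outer variables. -/
theorem bindCtx_mem {σ : Var → Term} : ∀ {l : List Var} {ys : Finset Var}, l.Nodup →
    (∀ x ∈ l, x ∉ ys) → (∀ x ∈ l, (σ x).fv = ∅) → CtxIn (l.toFinset ∪ ys) (bindCtx σ l) ys
  | [], ys, _, _, _ => by simpa [bindCtx] using CtxIn.hole (xs := ys)
  | x :: l, ys, hl, hd, hσ => by
    rw [List.nodup_cons] at hl
    refine .appL (.lam (hd x (by simp)) ?_) (by simp [terms, hσ x (by simp)])
    have := bindCtx_mem (σ := σ) (ys := insert x ys) hl.2 (fun y hy => by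
      simp only [Finset.mem_insert, not_or]
      exact ⟨by rintro rfl; exact hl.1 hy, hd y (by simp [hy])⟩) (fun y hy => hσ y (by simp [hy]))
    simpa using this

/-- Firing the outermost redex turns `ρ` into its update at `x` by `σ x`; `ρ` accumulates the
redexes already fired. -/
theorem stackProb_bindCtx {σ : Var → Term} (S : FrameStack) (M : Term) :
    ∀ {l : List Var} {ρ : Var → Term}, (∀ x ∈ l, (σ x).fv = ∅) → Closing ρ →
      stackProb S (((bindCtx σ l).fill M).csub ρ) =
        stackProb S (M.csub fun y => if y ∈ l then σ y else ρ y)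
  | [], ρ, _, _ => by simp [bindCtx, Ctx.fill]
  | x :: l, ρ, hσ, hρ => by
    have hx : (σ x).fv = ∅ := hσ x (by simp)
    simp only [bindCtx, Ctx.fill, csub]
    rw [csub_of_closed hx, stackProb_app, stackProb_push_lam, subst_eq_csub _ _ hx,
      csub_csub _ (hρ.update x (Or.inl rfl))]
    have e : (fun y => (Function.update ρ x (.var x) y).csub (Function.update .var x (σ x))) =
        Function.update ρ x (σ x) := by
      funext y
      by_cases hy : y = x
      · subst hy; simp [csub]
      · rw [Function.update_of_ne hy, Function.update_of_ne hy]
        rcases hρ y with h | h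
        · simp [h, csub, Function.update_of_ne hy]
        · exact csub_of_closed h _
    rw [e, stackProb_bindCtx S M (fun y hy => hσ y (by simp [hy])) (hρ.update x (Or.inr hx))]
    congr 2
    funext y
    by_cases hy : y = x
    · subst hy; simp
    · simp [hy]

theorem CtxLE.ciuLE {xs : Finset Var} {M N : Term} (hM : M ∈ terms xs) (hN : N ∈ terms xs)
    (h : CtxLE xs M N) : CIULE xs M N := by
  intro σ hσ S hS
  have hσ : ∀ x ∈ xs, (σ x).fv = ∅ := fun x hx => Finset.subset_empty.1 (hσ x hx)
  have hl : ∀ x ∈ xs.toList, (σ x).fv = ∅ := by simpa using hσ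
  have hC : CtxIn xs (S.plugCtx (bindCtx σ xs.toList)) ∅ := by
    refine S.plugCtx_mem hS ?_
    simpa using bindCtx_mem (ys := ∅) xs.nodup_toList (by simp) hl
  have key : ∀ P ∈ terms xs,
      stackProb .nil ((S.plugCtx (bindCtx σ xs.toList)).fill P) = stackProb S (P.substAll σ) := by
    intro P hP
    -- Initially no redex has fired, so the accumulated substitution is the identity.
    rw [S.stackProb_plugCtx, ← csub_var ((bindCtx σ xs.toList).fill P),
      stackProb_bindCtx S P hl closing_var, substAll_eq_csub P fun x hx => Or.inr (hσ x (hP hx))]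
    congr 1
    exact csub_congr P fun x hx => by simp [hP hx]
  rw [← key M hM, ← key N hN]
  exact (ctxLE_iff hM hN).1 h _ hC

theorem ciuLE_iff_ctxLE {xs : Finset Var} {M N : Term} (hM : M ∈ terms xs) (hN : N ∈ terms xs) :
    CIULE xs M N ↔ CtxLE xs M N :=
  ⟨CIULE.ctxLE hM hN, CtxLE.ciuLE hM hN⟩

end ProbLambda

/-- The CIU preorder coincides with the probabilistic context preorder, and CIU-equivalence with
probabilistic context equivalence, on all (possibly open) terms. -/
theorem mainTheorem5 (xs : Finset ProbLambda.Var) (M N : ProbLambda.Term)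
    (hM : M ∈ ProbLambda.terms xs) (hN : N ∈ ProbLambda.terms xs) :
    (ProbLambda.CIULE xs M N ↔ ProbLambda.CtxLE xs M N) ∧
      (ProbLambda.CIUEquiv xs M N ↔ ProbLambda.CtxEquiv xs M N) :=
  ⟨ProbLambda.ciuLE_iff_ctxLE hM hN,
    and_congr (ProbLambda.ciuLE_iff_ctxLE hM hN) (ProbLambda.ciuLE_iff_ctxLE hN hM)⟩
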